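/- Consider a mixed multinomial logit (MMNL) trial-offer market with $N$ items and $K$ classes of consumers. Class $k$ has arrival rate $\lambda_k>0$ and weight $w_k=\lambda_k/\sum_l\lambda_l$; position $j\in[N]$ has visibility $v_j\ge 0$; item $i$ has appeal $a_{i,k}>0$ and quality $q_{i,k}\in[0,1]$ for class $k$; and $z\ge 0$ is a constant. A ranking $\sigma$ is a permutation of $[N]$, with item $i$ placed in position $\sigma(i)$. Consumers arrive one per period $t=0,1,2,\dots$. Let $d_i^t$ be the number of purchases of item $i$ before period $t$ (so $d^0=0$). Given the past, consumer $t$ belongs to class $k$ with probability $w_k$; a consumer of class $k$ then tries item $i$ with probability $$p_{i,k}(\sigma,d^t)=\frac{v_{\sigma(i)}(a_{i,k}+d_i^t)}{\sum_{j=1}^N v_{\sigma(j)}(a_{j,k}+d_j^t)+z}$$ (and tries nothing with the remaining probability), and, having tried item $i$, buys it with probability $q_{i,k}$. Let $\bar q_i=\sum_{k=1}^K w_k q_{i,k}$ and let $\phi_i^t=d_i^t/\sum_j d_j^t$ be the market share of item $i$. Theorem. Let the static ranking $\sigma$, used in all periods, be tie-breaking, i.e. there is an item $i^*$ with $v_{\sigma(i^*)}\bar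 q_{i^*}>v_{\sigma(i)}\bar q_i$ for all $i\ne i^*$, and assume $v_{\sigma(i)}\bar q_i>0$ for some item $i$ (this is automatic if $N\ge 2$). Then the market goes to a monopoly: in almost every realization there is an item whose market share converges to $1$ as $t\to\infty$. Moreover, there is exactly one item whose market share converges to $1$ in almost every realization, namely $$i^*=\operatorname*{argmax}_{1\le i\le N} v_{\sigma(i)}\bar q_i .$$ -/

import Mathlib

open MeasureTheory Filter
open scoped Topology ProbabilityTheory

/-- The data of a mixed multinomial logit (MMNL) trial-offer market with `N` items (and as many
positions) and `K` classes of consumers. -/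
structure MMNL (N K : ℕ) where
  /-- arrival rate of the consumers of class `k` -/
  rate : Fin K → ℝ
  rate_pos : ∀ k, 0 < rate k
  /-- visibility of the position `j` -/
  visibility : Fin N → ℝ
  visibility_nonneg : ∀ j, 0 ≤ visibility j
  /-- appeal of the item `i` for the class `k` -/
  appeal : Fin N → Fin K → ℝ
  appeal_pos : ∀ i k, 0 < appeal i k
  /-- quality of item `i` for class `k`: the probability that a consumer of class `k` who tries
  item `i` buys it -/
  quality : Fin N → Fin K → ℝ
  quality_nonneg : ∀ i k, 0 ≤ quality i k
  quality_le_one : ∀ i k, quality i k ≤ 1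
  /-- the weight of trying nothing -/
  z : ℝ
  z_nonneg : 0 ≤ z

/-- A ranking policy maps the vector of past purchases to a ranking `σ` of the items; `σ i` is the
position of item `i`. -/
abbrev RankingPolicy (N : ℕ) : Type := (Fin N → ℕ) → Equiv.Perm (Fin N)

/-- The static ranking policy that always displays the ranking `σ`. -/
def staticPolicy {N : ℕ} (σ : Equiv.Perm (Fin N)) : RankingPolicy N := fun _ => σ

namespace MMNL

variable {N K : ℕ}

/-- The weight of class `k`: the probability that the next consumer belongs to class `k`. -/
noncomputable def weight (M : MMNL N K) (k : Fin K) : ℝ :=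
  M.rate k / ∑ l, M.rate l

/-- The probability that a consumer of class `k` tries item `i`, when the ranking is `σ` and she
sees the popularity signal `d`. -/
noncomputable def tryProb (M : MMNL N K) (σ : Equiv.Perm (Fin N)) (d : Fin N → ℕ)
    (i : Fin N) (k : Fin K) : ℝ :=
  M.visibility (σ i) * (M.appeal i k + (d i : ℝ)) /
    ((∑ j, M.visibility (σ j) * (M.appeal j k + (d j : ℝ))) + M.z)

/-- The weighted average quality of item `i`. -/
noncomputable def avgQuality (M : MMNL N K) (i : Fin N) : ℝ :=
  ∑ k, M.weight k * M.quality i k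

/-- The static ranking `σ` is tie-breaking: a unique item has the highest product of visibility and
weighted average quality. -/
def TieBreaking (M : MMNL N K) (σ : Equiv.Perm (Fin N)) : Prop :=
  ∃ iStar : Fin N, ∀ i : Fin N, i ≠ iStar →
    M.avgQuality i * M.visibility (σ i) < M.avgQuality iStar * M.visibility (σ iStar)

end MMNL

/-- The number of purchases of item `i` by the consumers `0, …, t - 1`, where `tried s` is the item
that consumer `s` tries (`none` if she tries nothing), and `bought s` tells whether she buys the
item that she tries. -/
def purchases {Ω : Type*} {N : ℕ} (tried : ℕ → Ω → Option (Fin N)) (bought : ℕ → Ω → Bool)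
    (t : ℕ) (ω : Ω) (i : Fin N) : ℕ :=
  ((Finset.range t).filter fun s => tried s ω = some i ∧ bought s ω = true).card

/-- The market share of item `i` when the vector of purchases is `d`. -/
noncomputable def marketShare {N : ℕ} (d : Fin N → ℕ) (i : Fin N) : ℝ :=
  (d i : ℝ) / ∑ j, (d j : ℝ)

/-- `cls`, `tried` and `bought` form a realization, on the probability space `(Ω, P)`, of the market
`M` with the popularity signal and the ranking policy `f`: `cls t` is the class of consumer `t`,
`tried t` the item that she tries (`none` if she tries nothing), and `bought t` tells whether she
buys the item that she tries. `ℱ t` is the information available just before consumer `t` arrives.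
Given `ℱ t`, she belongs to class `k` with probability `weight k`; a consumer of class `k` then
tries item `i` with probability `tryProb`, for the current popularity signal and the ranking that
`f` selects for it; having tried `i`, she buys it with probability `quality i k`. -/
structure MMNL.IsMarketDynamics {N K : ℕ} (M : MMNL N K) (f : RankingPolicy N)
    {Ω : Type*} {mΩ : MeasurableSpace Ω} (P : Measure Ω) (ℱ : Filtration ℕ mΩ)
    (cls : ℕ → Ω → Fin K) (tried : ℕ → Ω → Option (Fin N)) (bought : ℕ → Ω → Bool) : Prop where
  cls_meas : ∀ t k, MeasurableSet[ℱ (t + 1)] {ω | cls t ω = k}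
  tried_meas : ∀ t x, MeasurableSet[ℱ (t + 1)] {ω | tried t ω = x}
  bought_meas : ∀ t, MeasurableSet[ℱ (t + 1)] {ω | bought t ω = true}
  cls_law : ∀ t k, P⟦{ω | cls t ω = k} | ℱ t⟧ =ᵐ[P] fun _ => M.weight k
  tried_law : ∀ t k i, P⟦{ω | cls t ω = k ∧ tried t ω = some i} | ℱ t⟧ =ᵐ[P] fun ω =>
    M.weight k *
      M.tryProb (f (purchases tried bought t ω)) (purchases tried bought t ω) i k
  bought_law : ∀ t k i,
    P⟦{ω | cls t ω = k ∧ tried t ω = some i ∧ bought t ω = true} | ℱ t⟧ =ᵐ[P] fun ω =>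
      M.weight k *
        M.tryProb (f (purchases tried bought t ω)) (purchases tried bought t ω) i k *
          M.quality i k

/-- The purchase process `d` goes to a monopoly: in almost every realization, the market share of
some item (which may depend on the realization) converges to `1`. -/
def GoesToMonopoly {Ω : Type*} {mΩ : MeasurableSpace Ω} {N : ℕ} (P : Measure Ω)
    (d : ℕ → Ω → Fin N → ℕ) : Prop :=
  ∀ᵐ ω ∂P, ∃ i, Tendsto (fun t => marketShare (d t ω) i) atTop (𝓝 1)

/-- Item `i` goes predictably to a monopoly: in almost every realization, its market share
converges to `1`. -/
def GoesPredictablyToMonopoly {Ω : Type*} {mΩ : MeasurableSpace Ω} {N : ℕ} (P : Measure Ω)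
    (d : ℕ → Ω → Fin N → ℕ) (i : Fin N) : Prop :=
  ∀ᵐ ω ∂P, Tendsto (fun t => marketShare (d t ω) i) atTop (𝓝 1)

/-! Write `i` for the best item, `b` for another, `S = ∑ j, v_{σ(j)} d_j`. Appeals, `z` and the
consumer classes change the trial denominators only by bounded amounts. So when purchases are many,
`d_b` grows at relative rate at most `v_{σ(b)} q̄_b / S` and `d_i` at about `v_{σ(i)} q̄_i / S`.
Choose `θ < 1` with `v_{σ(b)} q̄_b < θ v_{σ(i)} q̄_i`. Then `(c + d_b) / d_i ^ θ` has nonpositive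
drift once `d_i` is large (`exists_relative_growth_le`, `drift_ratio_nonpos`). It is therefore a
nonnegative supermartingale from then on, and converges (`ae_exists_tendsto_comp`).

Each purchase of `i` has conditional probability at least of order `1 / (t + 1)`, a divergent
series, so `d_i → ∞` by Lévy's conditional Borel–Cantelli lemma (`ae_tendsto_purchases_atTop`). As
`θ < 1`, convergence of the ratio with exponent `θ` forces `d_b / d_i → 0` for every `b ≠ i`, hence
the share of `i` tends to `1`. -/

namespace MMNL

/-! ### One-step purchase probabilities and drift -/

variable {N K : ℕ}

/-- The probability that a consumer who sees the purchases `d` buys item `i`. -/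
noncomputable def buyProb (M : MMNL N K) (σ : Equiv.Perm (Fin N)) (d : Fin N → ℕ) (i : Fin N) :
    ℝ :=
  ∑ k, M.weight k * M.tryProb σ d i k * M.quality i k

theorem weight_nonneg (M : MMNL N K) (k : Fin K) : 0 ≤ M.weight k :=
  div_nonneg (M.rate_pos k).le (Finset.sum_nonneg fun l _ => (M.rate_pos l).le)

theorem avgQuality_nonneg (M : MMNL N K) (i : Fin N) : 0 ≤ M.avgQuality i :=
  Finset.sum_nonneg fun k _ => mul_nonneg (M.weight_nonneg k) (M.quality_nonneg i k)

theorem attraction_nonneg (M : MMNL N K) (σ : Equiv.Perm (Fin N)) (d : Fin N → ℕ) (i : Fin N)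
    (k : Fin K) : 0 ≤ M.visibility (σ i) * (M.appeal i k + (d i : ℝ)) :=
  mul_nonneg (M.visibility_nonneg _) (add_nonneg (M.appeal_pos i k).le (Nat.cast_nonneg _))

theorem denominator_pos (M : MMNL N K) (σ : Equiv.Perm (Fin N)) (d : Fin N → ℕ) {i : Fin N}
    (hi : 0 < M.visibility (σ i)) (k : Fin K) :
    0 < (∑ j, M.visibility (σ j) * (M.appeal j k + (d j : ℝ))) + M.z := by
  refine add_pos_of_pos_of_nonneg ?_ M.z_nonneg
  refine Finset.sum_pos' (fun j _ => M.attraction_nonneg σ d j k) ⟨i, Finset.mem_univ i, ?_⟩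
  exact mul_pos hi (add_pos_of_pos_of_nonneg (M.appeal_pos i k) (Nat.cast_nonneg _))

/-- The chance that item `i` is bought at time `t` is at least of order `1 / (t + 1)`. -/
theorem exists_div_le_buyProb (M : MMNL N K) (σ : Equiv.Perm (Fin N)) {i : Fin N}
    (hi : 0 < M.visibility (σ i)) (hq : 0 < M.avgQuality i) :
    ∃ c : ℝ, 0 < c ∧ ∀ (t : ℕ) (d : Fin N → ℕ), (∀ j, d j ≤ t) →
      c / ((t : ℝ) + 1) ≤ M.buyProb σ d i := by
  -- `B k` is the denominator with one purchase of each item; since `a + d ≤ (a + 1) * (t + 1)` for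
  -- `d ≤ t`, the denominator at time `t` is at most `B k * (t + 1)`.
  set B : Fin K → ℝ := fun k => (∑ j, M.visibility (σ j) * (M.appeal j k + 1)) + M.z with hB
  have hBpos : ∀ k, 0 < B k := fun k => by
    simpa [hB] using M.denominator_pos σ (fun _ => 1) hi k
  refine ⟨∑ k, M.weight k * (M.visibility (σ i) * M.appeal i k / B k) * M.quality i k, ?_, ?_⟩
  · obtain ⟨k, -, hk⟩ := Finset.exists_lt_of_sum_lt
      (f := fun _ => (0 : ℝ)) (by simpa [avgQuality] using hq)
    refine Finset.sum_pos' (fun l _ => ?_) ⟨k, Finset.mem_univ k, ?_⟩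
    · have := M.weight_nonneg l
      have := M.quality_nonneg i l
      have := (M.appeal_pos i l).le
      have := (hBpos l).le
      positivity
    · have h1 : 0 < M.visibility (σ i) * M.appeal i k / B k :=
        div_pos (mul_pos hi (M.appeal_pos i k)) (hBpos k)
      calc 0 < (M.weight k * M.quality i k) * (M.visibility (σ i) * M.appeal i k / B k) :=
            mul_pos hk h1
        _ = _ := by ring
  · intro t d hd
    rw [buyProb, Finset.sum_div]
    refine Finset.sum_le_sum fun k _ => ?_
    have hD := M.denominator_pos σ d hi k
    have hDB : (∑ j, M.visibility (σ j) * (M.appeal j k + (d j : ℝ))) + M.z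
        ≤ B k * ((t : ℝ) + 1) := by
      rw [hB, add_mul, Finset.sum_mul]
      refine add_le_add (Finset.sum_le_sum fun j _ => ?_) ?_
      · rw [mul_assoc]
        refine mul_le_mul_of_nonneg_left ?_ (M.visibility_nonneg _)
        have h1 : (d j : ℝ) ≤ t := by exact_mod_cast hd j
        nlinarith [mul_nonneg (M.appeal_pos j k).le (Nat.cast_nonneg (α := ℝ) t)]
      · nlinarith [mul_nonneg M.z_nonneg (Nat.cast_nonneg (α := ℝ) t)]
    have hkey : M.visibility (σ i) * M.appeal i k / B k / ((t : ℝ) + 1) ≤ M.tryProb σ d i k := by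
      rw [div_div, tryProb]
      refine div_le_div₀ (M.attraction_nonneg σ d i k) ?_ hD hDB
      exact mul_le_mul_of_nonneg_left (le_add_of_nonneg_right (Nat.cast_nonneg _)) hi.le
    calc M.weight k * (M.visibility (σ i) * M.appeal i k / B k) * M.quality i k / ((t : ℝ) + 1)
        = M.weight k * (M.visibility (σ i) * M.appeal i k / B k / ((t : ℝ) + 1)) *
            M.quality i k := by ring
      _ ≤ _ := mul_le_mul_of_nonneg_right
            (mul_le_mul_of_nonneg_left hkey (M.weight_nonneg k)) (M.quality_nonneg i k)

/-- Upper bound on the chance that `i` is bought, once some visible item has been bought. -/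
theorem buyProb_le (M : MMNL N K) (σ : Equiv.Perm (Fin N)) (d : Fin N → ℕ) (i : Fin N)
    {c : ℝ} (hc : ∀ k, M.appeal i k ≤ c)
    (hS : 0 < ∑ j, M.visibility (σ j) * (d j : ℝ)) :
    M.buyProb σ d i ≤ (c + d i) * (M.visibility (σ i) * M.avgQuality i /
      ∑ j, M.visibility (σ j) * (d j : ℝ)) := by
  have : (c + d i) * (M.visibility (σ i) * M.avgQuality i /
      ∑ j, M.visibility (σ j) * (d j : ℝ)) = ∑ k, M.weight k * (M.visibility (σ i) * (c + d i) /
      ∑ j, M.visibility (σ j) * (d j : ℝ)) * M.quality i k := by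
    rw [avgQuality, Finset.mul_sum, Finset.sum_div, Finset.mul_sum]
    exact Finset.sum_congr rfl fun k _ => by ring
  rw [this, buyProb]
  refine Finset.sum_le_sum fun k _ => mul_le_mul_of_nonneg_right
    (mul_le_mul_of_nonneg_left ?_ (M.weight_nonneg k)) (M.quality_nonneg i k)
  refine div_le_div₀ ((M.attraction_nonneg σ d i k).trans ?_) ?_ hS ?_
  · gcongr
    · exact M.visibility_nonneg _
    · exact hc k
  · gcongr
    · exact M.visibility_nonneg _
    · exact hc k
  · refine le_add_of_le_of_nonneg (Finset.sum_le_sum fun j _ => ?_) M.z_nonneg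
    exact mul_le_mul_of_nonneg_left (le_add_of_nonneg_left (M.appeal_pos j k).le)
      (M.visibility_nonneg _)

/-- Lower bound on the chance that `i` is bought. -/
theorem le_buyProb (M : MMNL N K) (σ : Equiv.Perm (Fin N)) (d : Fin N → ℕ) {i : Fin N}
    (hi : 0 < M.visibility (σ i)) {A : ℝ}
    (hA : ∀ k, (∑ j, M.visibility (σ j) * M.appeal j k) + M.z ≤ A) :
    d i * (M.visibility (σ i) * M.avgQuality i /
      ((∑ j, M.visibility (σ j) * (d j : ℝ)) + A)) ≤ M.buyProb σ d i := by
  have : d i * (M.visibility (σ i) * M.avgQuality i /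
      ((∑ j, M.visibility (σ j) * (d j : ℝ)) + A)) = ∑ k, M.weight k * (M.visibility (σ i) * d i /
      ((∑ j, M.visibility (σ j) * (d j : ℝ)) + A)) * M.quality i k := by
    rw [avgQuality, Finset.mul_sum, Finset.sum_div, Finset.mul_sum]
    exact Finset.sum_congr rfl fun k _ => by ring
  rw [this, buyProb]
  refine Finset.sum_le_sum fun k _ => mul_le_mul_of_nonneg_right
    (mul_le_mul_of_nonneg_left ?_ (M.weight_nonneg k)) (M.quality_nonneg i k)
  refine div_le_div₀ (M.attraction_nonneg σ d i k) ?_ (M.denominator_pos σ d hi k) ?_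
  · exact mul_le_mul_of_nonneg_left (le_add_of_nonneg_left (M.appeal_pos i k).le) hi.le
  · simp only [mul_add, Finset.sum_add_distrib]
    linarith [hA k]

/-- If the product of visibility and quality is larger for `i` than for `b`, even after a
reduction by the factor `θ`, then `i` has the larger relative growth rate once it has been bought
often enough. -/
theorem exists_relative_growth_le (M : MMNL N K) (σ : Equiv.Perm (Fin N)) {i b : Fin N}
    (hi : 0 < M.visibility (σ i)) {c θ : ℝ} (hc : ∀ k, M.appeal b k ≤ c) (hc0 : 0 < c)
    (hθ : M.visibility (σ b) * M.avgQuality b < θ * (M.visibility (σ i) * M.avgQuality i)) :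
    ∃ D : ℕ, 0 < D ∧ ∀ d : Fin N → ℕ, D ≤ d i →
      M.buyProb σ d b / (c + d b) ≤ θ / (d i + 1) * M.buyProb σ d i := by
  obtain ⟨A, hA0, hA⟩ : ∃ A : ℝ, 0 ≤ A ∧
      ∀ k, (∑ j, M.visibility (σ j) * M.appeal j k) + M.z ≤ A := by
    have h0 : ∀ k, 0 ≤ (∑ j, M.visibility (σ j) * M.appeal j k) + M.z := fun k =>
      add_nonneg (Finset.sum_nonneg fun j _ =>
        mul_nonneg (M.visibility_nonneg _) (M.appeal_pos j k).le) M.z_nonneg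
    exact ⟨∑ k, ((∑ j, M.visibility (σ j) * M.appeal j k) + M.z),
      Finset.sum_nonneg fun k _ => h0 k,
      fun k => Finset.single_le_sum (fun k _ => h0 k) (Finset.mem_univ k)⟩
  set u := M.visibility (σ i) with hu
  set r := M.visibility (σ b) * M.avgQuality b with hr
  set m := θ * (u * M.avgQuality i) with hm
  have hr0 : 0 ≤ r := mul_nonneg (M.visibility_nonneg _) (M.avgQuality_nonneg b)
  have hθ0 : 0 ≤ θ := by
    have h1 : 0 ≤ u * M.avgQuality i := mul_nonneg hi.le (M.avgQuality_nonneg i)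
    by_contra! h
    nlinarith
  -- The three summands yield `1 ≤ y`, `2r ≤ y(m - r)` and, through `u y ≤ S`, `4Ar ≤ S(m - r)`. The
  -- goal `r(S + A)(y + 1) ≤ y m S` amounts to `rS + rA(y + 1) ≤ yS(m - r)`, and each term on the
  -- left is at most half of the right side.
  obtain ⟨D, hD⟩ := exists_nat_ge (1 + 2 * r / (m - r) + 4 * A * r / (u * (m - r)))
  have hmr : 0 < m - r := sub_pos.2 hθ
  have hx : 0 ≤ 2 * r / (m - r) := by positivity
  have hy : 0 ≤ 4 * A * r / (u * (m - r)) := by positivity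
  refine ⟨D, by have : (0 : ℝ) < D := by linarith
                exact_mod_cast this, fun d hd => ?_⟩
  have hdD : (D : ℝ) ≤ d i := by exact_mod_cast hd
  set y : ℝ := ((d i : ℕ) : ℝ) with hy'
  set S := ∑ j, M.visibility (σ j) * (d j : ℝ) with hS
  have hSy : u * y ≤ S := Finset.single_le_sum (f := fun j => M.visibility (σ j) * (d j : ℝ))
    (fun j _ => mul_nonneg (M.visibility_nonneg _) (Nat.cast_nonneg _)) (Finset.mem_univ i)
  have hy1 : 1 ≤ y := by linarith
  have hS0 : 0 < S := lt_of_lt_of_le (by positivity) hSy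
  have hyr : 2 * r ≤ y * (m - r) := by
    rw [← div_le_iff₀ hmr]; linarith
  have hyA : 4 * A * r ≤ S * (m - r) := by
    have h1 : 4 * A * r ≤ y * (u * (m - r)) := by
      rw [← div_le_iff₀ (by positivity)]; linarith
    nlinarith
  have hmain : r / S ≤ y * m / ((S + A) * (y + 1)) := by
    rw [div_le_div_iff₀ hS0 (by positivity)]
    have h1 := mul_le_mul_of_nonneg_left hyr hS0.le
    have h2 := mul_le_mul_of_nonneg_left hyA (zero_le_one.trans hy1)
    have h3 : A * r ≤ A * r * y := le_mul_of_one_le_right (by positivity) hy1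
    nlinarith
  calc M.buyProb σ d b / (c + d b) ≤ r / S := by
        rw [div_le_iff₀ (by positivity), mul_comm]
        exact M.buyProb_le σ d b hc hS0
    _ ≤ y * m / ((S + A) * (y + 1)) := hmain
    _ = θ / (y + 1) * (y * (u * M.avgQuality i / (S + A))) := by
        rw [hm]; field_simp
    _ ≤ _ := mul_le_mul_of_nonneg_left (M.le_buyProb σ d hi hA) (by positivity)

/-- The expected one-step change of `g` in the state `d`. -/
noncomputable def drift (M : MMNL N K) (σ : Equiv.Perm (Fin N)) (g : (Fin N → ℕ) → ℝ)
    (d : Fin N → ℕ) : ℝ :=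
  ∑ i, (g (d + Pi.single i 1) - g d) * M.buyProb σ d i

/-- Only purchases of `b` and `i` move the ratio: one of `b` multiplies it by `1 + 1 / (c + d b)`,
one of `i` by at most `1 - θ / (d i + 1)`. The hypothesis `h` says that the expected gain does not
exceed the expected loss. -/
theorem drift_ratio_nonpos (M : MMNL N K) (σ : Equiv.Perm (Fin N)) {i b : Fin N} (hib : b ≠ i)
    {c θ : ℝ} (hc0 : 0 < c) (hθ0 : 0 ≤ θ) (hθ1 : θ ≤ 1) {d : Fin N → ℕ} (hd : 0 < d i)
    (hpi : 0 ≤ M.buyProb σ d i)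
    (h : M.buyProb σ d b / (c + d b) ≤ θ / (d i + 1) * M.buyProb σ d i) :
    M.drift σ (fun d => (c + d b) / (d i : ℝ) ^ θ) d ≤ 0 := by
  have hy : (0 : ℝ) < d i := by exact_mod_cast hd
  have hyθ : 0 < (d i : ℝ) ^ θ := Real.rpow_pos_of_pos hy θ
  have hcb : 0 < c + d b := by positivity
  rw [drift, ← Finset.sum_subset (Finset.subset_univ {b, i}), Finset.sum_pair hib]
  · have e1 : (c + ((d + Pi.single b 1 : Fin N → ℕ) b : ℝ)) /
        (((d + Pi.single b 1 : Fin N → ℕ) i : ℕ) : ℝ) ^ θ - (c + d b) / (d i : ℝ) ^ θ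
        = (c + d b) / (d i : ℝ) ^ θ * (1 / (c + d b)) := by
      simp [Pi.single_eq_of_ne hib.symm]
      field_simp
      ring
    have e2 : (c + ((d + Pi.single i 1 : Fin N → ℕ) b : ℝ)) /
        (((d + Pi.single i 1 : Fin N → ℕ) i : ℕ) : ℝ) ^ θ - (c + d b) / (d i : ℝ) ^ θ
        ≤ (c + d b) / (d i : ℝ) ^ θ * (-(θ / (d i + 1))) := by
      -- Bernoulli's inequality for an exponent in `[0, 1]`: `(y / (y + 1)) ^ θ ≤ 1 - θ / (y + 1)`.
      have hB := _root_.rpow_one_add_le_one_add_mul_self (s := -(1 / ((d i : ℝ) + 1))) (p := θ)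
        (by rw [neg_le_neg_iff, div_le_one (by positivity)]; linarith) hθ0 hθ1
      have e3 : 1 + -(1 / ((d i : ℝ) + 1)) = d i / (d i + 1) := by field_simp; ring
      rw [e3, Real.div_rpow hy.le (by positivity)] at hB
      have h1 : 0 < ((d i : ℝ) + 1) ^ θ := Real.rpow_pos_of_pos (by positivity) θ
      have e4 : (c + d b) / ((d i : ℝ) + 1) ^ θ =
          (c + d b) / (d i : ℝ) ^ θ * ((d i : ℝ) ^ θ / ((d i : ℝ) + 1) ^ θ) := by
        field_simp
      simp only [Pi.add_apply, Pi.single_eq_of_ne hib, Pi.single_eq_same, add_zero, Nat.cast_add,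
        Nat.cast_one]
      rw [e4]
      have := mul_le_mul_of_nonneg_left hB (div_pos hcb hyθ).le
      calc _ ≤ (c + d b) / (d i : ℝ) ^ θ * (1 + θ * -(1 / ((d i : ℝ) + 1)))
            - (c + d b) / (d i : ℝ) ^ θ := by linarith
        _ = _ := by ring
    rw [e1]
    have h3 := mul_le_mul_of_nonneg_left h (div_pos hcb hyθ).le
    have h4 := mul_le_mul_of_nonneg_right e2 hpi
    calc _ ≤ (c + d b) / (d i : ℝ) ^ θ * (1 / (c + d b)) * M.buyProb σ d b
          + (c + d b) / (d i : ℝ) ^ θ * (-(θ / (d i + 1))) * M.buyProb σ d i := by linarith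
      _ = (c + d b) / (d i : ℝ) ^ θ * (M.buyProb σ d b / (c + d b))
          - (c + d b) / (d i : ℝ) ^ θ * (θ / (d i + 1) * M.buyProb σ d i) := by ring
      _ ≤ 0 := by linarith
  · intro j _ hj
    simp only [Finset.mem_insert, Finset.mem_singleton, not_or] at hj
    simp [Pi.single_eq_of_ne (Ne.symm hj.1), Pi.single_eq_of_ne (Ne.symm hj.2)]

end MMNL

/-! ### Paths of the purchase vector -/

section Purchases

variable {Ω : Type*} {N : ℕ} {tried : ℕ → Ω → Option (Fin N)} {bought : ℕ → Ω → Bool}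

theorem purchases_succ_apply (t : ℕ) (ω : Ω) (i : Fin N) :
    purchases tried bought (t + 1) ω i = purchases tried bought t ω i +
      if tried t ω = some i ∧ bought t ω = true then 1 else 0 := by
  simp only [purchases, Finset.range_add_one, Finset.filter_insert]
  split_ifs with h <;> simp

theorem purchases_succ_of_some {t : ℕ} {ω : Ω} {i : Fin N} (h : tried t ω = some i)
    (hb : bought t ω = true) :
    purchases tried bought (t + 1) ω = purchases tried bought t ω + Pi.single i 1 := by
  ext j
  rw [purchases_succ_apply]
  by_cases hij : i = j
  · subst hij; simp [h, hb]
  · simp [h, hij]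

theorem purchases_le (t : ℕ) (ω : Ω) (i : Fin N) : purchases tried bought t ω i ≤ t :=
  (Finset.card_filter_le _ _).trans_eq (Finset.card_range t)

theorem purchases_mono (ω : Ω) (i : Fin N) : Monotone fun t => purchases tried bought t ω i :=
  monotone_nat_of_le_succ fun t => by rw [purchases_succ_apply]; exact Nat.le_add_right _ _

/-- Every function of the purchase vector is bounded at each time. -/
theorem exists_abs_comp_purchases_le (g : (Fin N → ℕ) → ℝ) (t : ℕ) :
    ∃ C, ∀ ω, |g (purchases tried bought t ω)| ≤ C := by
  have hfin : (Set.Iic (fun _ : Fin N => t)).Finite := Set.finite_Iic _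
  obtain ⟨C, hC⟩ := (hfin.image fun d => |g d|).bddAbove
  exact ⟨C, fun ω => hC ⟨_, fun i => purchases_le t ω i, rfl⟩⟩

/-- The exact one-step decomposition of a function of the purchase vector. -/
theorem comp_purchases_succ (g : (Fin N → ℕ) → ℝ) (t : ℕ) (ω : Ω) :
    g (purchases tried bought (t + 1) ω) = g (purchases tried bought t ω) +
      ∑ i, (g (purchases tried bought t ω + Pi.single i 1) - g (purchases tried bought t ω)) *
        {ω | tried t ω = some i ∧ bought t ω = true}.indicator (fun _ => (1 : ℝ)) ω := by
  by_cases h : ∃ i, tried t ω = some i ∧ bought t ω = true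
  · obtain ⟨i, hi, hb⟩ := h
    rw [purchases_succ_of_some hi hb, Finset.sum_eq_single i]
    · simp [hi, hb]
    · intro j _ hj
      simp [hi, Ne.symm hj]
    · simp
  · push Not at h
    have h0 : purchases tried bought (t + 1) ω = purchases tried bought t ω := by
      ext j
      rw [purchases_succ_apply, if_neg (fun hh => h j hh.1 hh.2), add_zero]
    rw [h0, Finset.sum_eq_zero, add_zero]
    intro j _
    rw [Set.indicator_of_notMem, mul_zero]
    exact fun hh => h j hh.1 hh.2

end Purchases

/-! ### Conditional laws and almost sure convergence -/

namespace MMNL.IsMarketDynamics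

variable {N K : ℕ} {M : MMNL N K} {σ : Equiv.Perm (Fin N)} {Ω : Type*} {mΩ : MeasurableSpace Ω}
  {P : Measure Ω} {ℱ : Filtration ℕ mΩ} {cls : ℕ → Ω → Fin K}
  {tried : ℕ → Ω → Option (Fin N)} {bought : ℕ → Ω → Bool}

theorem measurableSet_buy (h : M.IsMarketDynamics (staticPolicy σ) P ℱ cls tried bought)
    (t : ℕ) (i : Fin N) :
    MeasurableSet[ℱ (t + 1)] {ω | tried t ω = some i ∧ bought t ω = true} :=
  (h.tried_meas t _).inter (h.bought_meas t)

theorem measurable_purchases (h : M.IsMarketDynamics (staticPolicy σ) P ℱ cls tried bought)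
    (t : ℕ) : Measurable[ℱ t] (purchases tried bought t) := by
  induction t with
  | zero =>
    have : purchases tried bought 0 = fun _ _ => 0 := by
      ext ω i; simp [purchases]
    rw [this]
    exact measurable_const
  | succ t ih =>
    refine @measurable_pi_lambda _ _ _ (ℱ (t + 1)) _ _ fun i => ?_
    simp only [purchases_succ_apply]
    refine Measurable.add ?_ (Measurable.ite (h.measurableSet_buy t i) measurable_const
      measurable_const)
    exact (measurable_pi_apply i).comp (ih.mono (ℱ.mono t.le_succ) le_rfl)

theorem stronglyMeasurable_comp (h : M.IsMarketDynamics (staticPolicy σ) P ℱ cls tried bought)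
    (g : (Fin N → ℕ) → ℝ) (t : ℕ) :
    StronglyMeasurable[ℱ t] fun ω => g (purchases tried bought t ω) :=
  ((measurable_of_countable g).comp (h.measurable_purchases t)).stronglyMeasurable

variable [IsProbabilityMeasure P]

theorem integrable_comp (h : M.IsMarketDynamics (staticPolicy σ) P ℱ cls tried bought)
    (g : (Fin N → ℕ) → ℝ) (t : ℕ) : Integrable (fun ω => g (purchases tried bought t ω)) P := by
  obtain ⟨C, hC⟩ := exists_abs_comp_purchases_le (tried := tried) (bought := bought) g t
  exact Integrable.of_bound ((h.stronglyMeasurable_comp g t).mono (ℱ.le t)).aestronglyMeasurable C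
    (ae_of_all _ hC)

theorem condExp_buy (h : M.IsMarketDynamics (staticPolicy σ) P ℱ cls tried bought)
    (t : ℕ) (i : Fin N) :
    P⟦{ω | tried t ω = some i ∧ bought t ω = true} | ℱ t⟧ =ᵐ[P]
      fun ω => M.buyProb σ (purchases tried bought t ω) i := by
  have hm : ∀ k, MeasurableSet {ω | cls t ω = k ∧ tried t ω = some i ∧ bought t ω = true} :=
    fun k => ℱ.le (t + 1) _ ((h.cls_meas t k).inter (h.measurableSet_buy t i))
  have hsum : {ω | tried t ω = some i ∧ bought t ω = true}.indicator (fun _ => (1 : ℝ)) =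
      ∑ k, {ω | cls t ω = k ∧ tried t ω = some i ∧ bought t ω = true}.indicator
        (fun _ => (1 : ℝ)) := by
    ext ω
    rw [Finset.sum_apply, Finset.sum_eq_single (cls t ω)]
    · simp [Set.indicator]
    · intro k _ hk
      simp [Ne.symm hk]
    · simp
  rw [hsum]
  refine (condExp_finsetSum (fun k _ => (integrable_const (1 : ℝ)).indicator (hm k)) _).trans ?_
  have := ae_all_iff.2 fun k => h.bought_law t k i
  filter_upwards [this] with ω hω
  rw [Finset.sum_apply, buyProb]
  exact Finset.sum_congr rfl fun k _ => hω k

theorem condExp_comp_succ (h : M.IsMarketDynamics (staticPolicy σ) P ℱ cls tried bought)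
    (g : (Fin N → ℕ) → ℝ) (t : ℕ) :
    P[fun ω => g (purchases tried bought (t + 1) ω) | ℱ t] =ᵐ[P]
      fun ω => g (purchases tried bought t ω) + M.drift σ g (purchases tried bought t ω) := by
  set B : Fin N → Ω → ℝ := fun i =>
    {ω | tried t ω = some i ∧ bought t ω = true}.indicator (fun _ => (1 : ℝ)) with hB
  set G : Fin N → Ω → ℝ := fun i ω =>
    g (purchases tried bought t ω + Pi.single i 1) - g (purchases tried bought t ω) with hG
  have hBint : ∀ i, Integrable (B i) P := fun i =>
    (integrable_const (1 : ℝ)).indicator (ℱ.le (t + 1) _ (h.measurableSet_buy t i))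
  have hGm : ∀ i, StronglyMeasurable[ℱ t] (G i) := fun i =>
    h.stronglyMeasurable_comp (fun d => g (d + Pi.single i 1) - g d) t
  have hGB : ∀ i, Integrable (G i * B i) P := fun i => by
    obtain ⟨C, hC⟩ := exists_abs_comp_purchases_le (tried := tried) (bought := bought)
      (fun d => g (d + Pi.single i 1) - g d) t
    exact (hBint i).bdd_mul ((hGm i).mono (ℱ.le t)).aestronglyMeasurable (ae_of_all _ hC)
  have hdec : (fun ω => g (purchases tried bought (t + 1) ω)) =
      (fun ω => g (purchases tried bought t ω)) + ∑ i, G i * B i := by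
    ext ω
    simp only [Pi.add_apply, Finset.sum_apply, Pi.mul_apply]
    exact comp_purchases_succ g t ω
  rw [hdec]
  refine (condExp_add (h.integrable_comp g t) (integrable_finsetSum' _ fun i _ => hGB i) _).trans ?_
  rw [condExp_of_stronglyMeasurable (ℱ.le t) (h.stronglyMeasurable_comp g t)
    (h.integrable_comp g t)]
  have h1 := condExp_finsetSum (s := Finset.univ) (fun i _ => hGB i) (ℱ t)
  have h2 := ae_all_iff.2 fun i =>
    condExp_mul_of_stronglyMeasurable_left (m := ℱ t) (hGm i) (hGB i) (hBint i)
  have h3 := ae_all_iff.2 fun i => h.condExp_buy t i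
  filter_upwards [h1, h2, h3] with ω h1 h2 h3
  rw [Pi.add_apply, h1, Finset.sum_apply, drift]
  congr 1
  refine Finset.sum_congr rfl fun i _ => ?_
  rw [h2 i, Pi.mul_apply, h3 i]

/-- A nonnegative function of the purchases whose drift is nonpositive on an upward closed set of
states converges along almost every path that enters this set. -/
theorem ae_exists_tendsto_comp (h : M.IsMarketDynamics (staticPolicy σ) P ℱ cls tried bought)
    {g : (Fin N → ℕ) → ℝ} (hg : ∀ d, 0 ≤ g d) {S : Set (Fin N → ℕ)} (hS : IsUpperSet S)
    (hdrift : ∀ d ∈ S, M.drift σ g d ≤ 0) (s : ℕ) :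
    ∀ᵐ ω ∂P, purchases tried bought s ω ∈ S →
      ∃ L, Tendsto (fun t => g (purchases tried bought t ω)) atTop (𝓝 L) := by
  -- Restarting time at `s` makes `E` known from the outset. Purchases only increase and `S` is
  -- upward closed, so paths in `E` never leave `S`, and no stopping time is needed.
  let 𝒢 : Filtration ℕ mΩ :=
    ⟨fun n => ℱ (n + s), fun m n hmn => ℱ.mono (Nat.add_le_add_right hmn s), fun n => ℱ.le _⟩
  set E : Set Ω := {ω | purchases tried bought s ω ∈ S} with hE
  have hEm : ∀ n, MeasurableSet[ℱ (n + s)] E := fun n =>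
    ℱ.mono (Nat.le_add_left s n) _ (h.measurable_purchases s (Set.to_countable S).measurableSet)
  set X : ℕ → Ω → ℝ := fun n => E.indicator fun ω => g (purchases tried bought (n + s) ω) with hX
  have hXint : ∀ n, Integrable (X n) P := fun n =>
    (h.integrable_comp g (n + s)).indicator (ℱ.le _ _ (hEm n))
  have hX0 : ∀ n ω, 0 ≤ X n ω := fun n ω => Set.indicator_nonneg (fun _ _ => hg _) ω
  have hsup : Supermartingale X 𝒢 P := by
    refine supermartingale_nat
      (fun n => (h.stronglyMeasurable_comp g (n + s)).indicator (hEm n)) hXint fun n => ?_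
    have h1 := condExp_indicator (h.integrable_comp g (n + s + 1)) (hEm n)
    have h2 := h.condExp_comp_succ g (n + s)
    have e : X (n + 1) = E.indicator fun ω => g (purchases tried bought (n + s + 1) ω) := by
      simp only [hX, Nat.add_right_comm]
    rw [e]
    filter_upwards [h1, h2] with ω h1 h2
    refine h1.trans_le ?_
    by_cases hω : ω ∈ E
    · simp only [hX, Set.indicator_of_mem hω]
      rw [h2]
      have : purchases tried bought (n + s) ω ∈ S :=
        hS (fun i => purchases_mono ω i (Nat.le_add_left s n)) hω
      linarith [hdrift _ this]
    · simp [hX, hω]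
  -- For a nonnegative process the `L¹` norm is the expectation, which a supermartingale never
  -- raises above its initial value.
  have hbdd : ∀ n, eLpNorm ((-X) n) 1 P ≤ ((∫ ω, X 0 ω ∂P).toNNReal : NNReal) := by
    intro n
    rw [Pi.neg_apply, eLpNorm_neg, eLpNorm_one_eq_lintegral_enorm]
    have : ∀ ω, ‖X n ω‖ₑ = ENNReal.ofReal (X n ω) := fun ω => by
      rw [Real.enorm_eq_ofReal (hX0 n ω)]
    simp only [this]
    rw [← ofReal_integral_eq_lintegral_ofReal (hXint n) (ae_of_all _ (hX0 n))]
    refine ENNReal.ofReal_le_ofReal ?_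
    simpa using hsup.setIntegral_le (Nat.zero_le n) MeasurableSet.univ
  filter_upwards [hsup.neg.exists_ae_tendsto_of_bdd hbdd] with ω hω hmem
  obtain ⟨L, hL⟩ := hω
  refine ⟨-L, (tendsto_add_atTop_iff_nat s).1 (hL.neg.congr fun n => ?_)⟩
  simp [hX, Set.indicator_of_mem (show ω ∈ E from hmem)]

/-- An item with positive visibility and positive quality is bought infinitely often. -/
theorem ae_tendsto_purchases_atTop
    (h : M.IsMarketDynamics (staticPolicy σ) P ℱ cls tried bought) {i : Fin N}
    (hi : 0 < M.visibility (σ i)) (hq : 0 < M.avgQuality i) :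
    ∀ᵐ ω ∂P, Tendsto (fun t => purchases tried bought t ω i) atTop atTop := by
  obtain ⟨c, hc, hle⟩ := M.exists_div_le_buyProb σ hi hq
  -- The purchase by consumer `t` is known only at time `t + 1`; hence the shift of index, with the
  -- empty set at `0`.
  let s : ℕ → Set Ω := fun n => Nat.casesOn n ∅
    fun t => {ω | tried t ω = some i ∧ bought t ω = true}
  have hs : ∀ n, MeasurableSet[ℱ n] (s n) := by
    rintro (_ | n)
    · exact @MeasurableSet.empty _ (ℱ 0)
    · exact h.measurableSet_buy n i
  filter_upwards [ae_mem_limsup_atTop_iff P hs, ae_all_iff.2 fun t => h.condExp_buy t i]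
    with ω hω hp
  have hsum : Tendsto (fun n => ∑ k ∈ Finset.range n,
      (P[(s (k + 1)).indicator (1 : Ω → ℝ) | ℱ k]) ω) atTop atTop := by
    have hdiv := (Real.tendsto_sum_range_one_div_nat_succ_atTop).const_mul_atTop hc
    refine tendsto_atTop_mono (fun n => ?_) hdiv
    rw [Finset.mul_sum]
    refine Finset.sum_le_sum fun k _ => ?_
    rw [mul_one_div]
    exact (hle k _ fun j => purchases_le k ω j).trans_eq (hp k).symm
  have hfreq := mem_limsup_iff_frequently_mem.1 (hω.2 hsum)
  refine tendsto_atTop_atTop_of_monotone (purchases_mono ω i) fun b => ?_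
  induction b with
  | zero => exact ⟨0, Nat.zero_le _⟩
  | succ b ih =>
    obtain ⟨a, ha⟩ := ih
    obtain ⟨n, hn, hmem⟩ := frequently_atTop.1 hfreq (a + 1)
    obtain ⟨t, rfl⟩ : ∃ t, n = t + 1 := ⟨n - 1, by omega⟩
    refine ⟨t + 1, ?_⟩
    have hat := purchases_mono (tried := tried) (bought := bought) ω i (show a ≤ t by omega)
    have : tried t ω = some i ∧ bought t ω = true := hmem
    rw [purchases_succ_apply, if_pos this]
    simp only at hat
    omega

/-- An item with a smaller product of visibility and quality is negligible. -/
theorem ae_tendsto_ratio_zero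
    (h : M.IsMarketDynamics (staticPolicy σ) P ℱ cls tried bought) {i b : Fin N}
    (hpos : 0 < M.visibility (σ i) * M.avgQuality i)
    (hlt : M.visibility (σ b) * M.avgQuality b < M.visibility (σ i) * M.avgQuality i) :
    ∀ᵐ ω ∂P, Tendsto (fun t => (purchases tried bought t ω b : ℝ) / purchases tried bought t ω i)
      atTop (𝓝 0) := by
  have hi : 0 < M.visibility (σ i) :=
    pos_of_mul_pos_left hpos (M.avgQuality_nonneg i)
  have hq : 0 < M.avgQuality i := pos_of_mul_pos_right hpos hi.le
  have hib : b ≠ i := by rintro rfl; exact lt_irrefl _ hlt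
  obtain ⟨θ, hθ, hθ1⟩ := exists_between ((div_lt_one hpos).2 hlt)
  have hθ0 : 0 ≤ θ := (div_nonneg (mul_nonneg (M.visibility_nonneg _)
    (M.avgQuality_nonneg b)) hpos.le).trans hθ.le
  -- `c` dominates the appeal of `b` for all classes at once; the `1` keeps it positive even without
  -- classes.
  set c : ℝ := 1 + ∑ k, M.appeal b k with hc
  have hc0 : 0 < c := add_pos_of_pos_of_nonneg one_pos
    (Finset.sum_nonneg fun k _ => (M.appeal_pos b k).le)
  have hca : ∀ k, M.appeal b k ≤ c := fun k =>
    (Finset.single_le_sum (fun k _ => (M.appeal_pos b k).le) (Finset.mem_univ k)).trans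
      (le_add_of_nonneg_left zero_le_one)
  obtain ⟨D, hD0, hD⟩ := M.exists_relative_growth_le σ hi hca hc0 ((div_lt_iff₀ hpos).1 hθ)
  have hpi : ∀ d, 0 ≤ M.buyProb σ d i := fun d => Finset.sum_nonneg fun k _ =>
    mul_nonneg (mul_nonneg (M.weight_nonneg k) (div_nonneg (M.attraction_nonneg σ d i k)
      (M.denominator_pos σ d hi k).le)) (M.quality_nonneg i k)
  -- The time at which `d i` reaches `D` is random; one null set serves all the countably many
  -- deterministic `s`.
  have hconv := ae_all_iff.2 fun s => h.ae_exists_tendsto_comp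
    (g := fun d => (c + d b) / (d i : ℝ) ^ θ) (S := {d | D ≤ d i}) (fun d => by positivity)
    (fun d d' hdd hd => le_trans hd (hdd i))
    (fun d hd => M.drift_ratio_nonpos σ hib hc0 hθ0 hθ1.le (hD0.trans_le hd) (hpi d) (hD d hd)) s
  filter_upwards [hconv, h.ae_tendsto_purchases_atTop hi hq] with ω hω htop
  obtain ⟨s, hs⟩ := (htop.eventually_ge_atTop D).exists
  obtain ⟨L, hL⟩ := hω s hs
  have hy : Tendsto (fun t => (purchases tried bought t ω i : ℝ)) atTop atTop :=
    tendsto_natCast_atTop_atTop.comp htop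
  -- With `y = d i`: `d b / y = ((c + d b) / y ^ θ) * y ^ (θ - 1) - c / y`, where the first factor
  -- converges and `y → ∞`.
  have hpow := (tendsto_rpow_neg_atTop (sub_pos.2 hθ1)).comp hy
  have hprod := hL.mul hpow
  rw [mul_zero] at hprod
  have hcy := hy.const_div_atTop c
  have := hprod.sub hcy
  rw [sub_zero] at this
  refine this.congr' ?_
  filter_upwards [hy.eventually_gt_atTop 0] with t ht
  rw [Function.comp_apply, neg_sub, Real.rpow_sub ht, Real.rpow_one]
  have := Real.rpow_pos_of_pos ht θ
  field_simp
  ring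

end MMNL.IsMarketDynamics

/-! ### Market shares and conclusion -/

theorem tendsto_marketShare_one {N : ℕ} {d : ℕ → Fin N → ℕ} {i : Fin N}
    (htop : Tendsto (fun t => d t i) atTop atTop)
    (hratio : ∀ b, b ≠ i → Tendsto (fun t => (d t b : ℝ) / d t i) atTop (𝓝 0)) :
    Tendsto (fun t => marketShare (d t) i) atTop (𝓝 1) := by
  have h1 : ∀ j, Tendsto (fun t => (d t j : ℝ) / d t i) atTop (𝓝 (if j = i then 1 else 0)) := by
    intro j
    split_ifs with hj
    · subst hj
      refine tendsto_const_nhds.congr' ?_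
      filter_upwards [htop.eventually_gt_atTop 0] with t ht
      rw [div_self (by exact_mod_cast ht.ne')]
    · exact hratio j hj
  -- The sum of these ratios over all items is the reciprocal of the market share of `i`.
  have h2 := tendsto_finsetSum Finset.univ fun j _ => h1 j
  rw [Finset.sum_ite_eq' Finset.univ i, if_pos (Finset.mem_univ i)] at h2
  have h3 := h2.inv₀ one_ne_zero
  rw [inv_one] at h3
  refine h3.congr fun t => ?_
  rw [marketShare, ← Finset.sum_div, inv_div]

theorem marketShare_add_le_one {N : ℕ} (d : Fin N → ℕ) {i j : Fin N} (hij : i ≠ j) :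
    marketShare d i + marketShare d j ≤ 1 := by
  rw [marketShare, marketShare, ← add_div]
  refine div_le_one_of_le₀ ?_ (Finset.sum_nonneg fun _ _ => Nat.cast_nonneg _)
  rw [← Finset.sum_pair (f := fun k => (d k : ℝ)) hij]
  exact Finset.sum_le_sum_of_subset_of_nonneg (Finset.subset_univ _)
    fun _ _ _ => Nat.cast_nonneg _

/-- Two almost sure events of a probability space share a point, and there two distinct shares would
have limits summing to `2`, although their sum never exceeds `1`. -/
theorem GoesPredictablyToMonopoly.unique {Ω : Type*} {mΩ : MeasurableSpace Ω} {N : ℕ}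
    {P : Measure Ω} [IsProbabilityMeasure P] {d : ℕ → Ω → Fin N → ℕ} {i j : Fin N}
    (hi : GoesPredictablyToMonopoly P d i) (hj : GoesPredictablyToMonopoly P d j) : i = j := by
  by_contra hij
  obtain ⟨ω, h1, h2⟩ := (hi.and hj).exists
  have := le_of_tendsto' (h1.add h2) fun t => marketShare_add_le_one (d t ω) hij
  norm_num at this

theorem mainTheorem2 {N K : ℕ} (M : MMNL N K) (σ : Equiv.Perm (Fin N))
    (htie : M.TieBreaking σ)
    (hpos : ∃ i, 0 < M.visibility (σ i) * M.avgQuality i)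
    {Ω : Type*} {mΩ : MeasurableSpace Ω} (P : Measure Ω) [IsProbabilityMeasure P]
    (ℱ : Filtration ℕ mΩ)
    (cls : ℕ → Ω → Fin K) (tried : ℕ → Ω → Option (Fin N)) (bought : ℕ → Ω → Bool)
    (hproc : M.IsMarketDynamics (staticPolicy σ) P ℱ cls tried bought) :
    GoesToMonopoly P (purchases tried bought) ∧
      ∃ iStar : Fin N,
        (∀ i, i ≠ iStar →
          M.visibility (σ i) * M.avgQuality i < M.visibility (σ iStar) * M.avgQuality iStar) ∧
        ∀ i, GoesPredictablyToMonopoly P (purchases tried bought) i ↔ i = iStar := by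
  obtain ⟨iStar, hstar⟩ := htie
  have hlt : ∀ i, i ≠ iStar →
      M.visibility (σ i) * M.avgQuality i < M.visibility (σ iStar) * M.avgQuality iStar :=
    fun i hi => by simpa only [mul_comm] using hstar i hi
  have hstar_pos : 0 < M.visibility (σ iStar) * M.avgQuality iStar := by
    obtain ⟨i, hi⟩ := hpos
    by_cases h : i = iStar
    · rwa [← h]
    · exact hi.trans (hlt i h)
  have hvis : 0 < M.visibility (σ iStar) :=
    pos_of_mul_pos_left hstar_pos (M.avgQuality_nonneg iStar)
  have hmono : GoesPredictablyToMonopoly P (purchases tried bought) iStar := by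
    have hratio := ae_all_iff.2 fun b => ae_all_iff.2 fun hb : b ≠ iStar =>
      hproc.ae_tendsto_ratio_zero hstar_pos (hlt b hb)
    filter_upwards [hratio, hproc.ae_tendsto_purchases_atTop hvis
      (pos_of_mul_pos_right hstar_pos hvis.le)] with ω h1 h2
    exact tendsto_marketShare_one h2 h1
  refine ⟨hmono.mono fun ω hω => ⟨iStar, hω⟩, iStar, hlt, fun i => ⟨fun h => h.unique hmono, ?_⟩⟩
  rintro rfl
  exact hmono
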